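/- Let $(\mathbb F, M, G, K)$ be one of the following, where $\mathbb H$ denotes the quaternions: - $\mathbb F=\mathbb R$, $M=SO_n$, $G=O_o(n,n)$ (the identity component of $O(n,n)$), $K=SO_n\times SO_n$, with $n>2$; - $\mathbb F=\mathbb C$, $M=U_n$, $G=SU(n,n)$, $K=S(U_n\times U_n)$, with $n\ge 1$; - $\mathbb F=\mathbb H$, $M=Sp_n$, $G=Sp(n,n)$, $K=Sp_n\times Sp_n$, with $n\ge 1$. Here $O(n,n)$, $U(n,n)$, $Sp(n,n)$ are the groups of $2n\times 2n$ matrices over $\mathbb F$ that preserve the form $\bar x^{T}\xi-\bar y^{T}\eta$ on $\mathbb F^n\times\mathbb F^n$, $SU(n,n)$ is the subgroup of $U(n,n)$ of matrices of determinant $1$, and $K\subset G$ is embedded as block diagonal matrices $\operatorname{diag}(A,D)$ with $A,D\in M$ (and $\det A\det D=1$ if $\mathbb F=\mathbb C$). The group $G$ acts on $M$ by $$\begin{pmatrix}A&B\\ C&D\end{pmatrix}\ast U=(AU+B)(CU+D)^{-1}.$$ Let $M$ carry the Riemannian metric induced from the inner product $\langle X,Y\rangle=\operatorname{Re}\operatorname{tr}(\overline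 X^{T}Y)$ on $\mathbb F^{n\times n}$, with Riemannian volume measure $\mu$, and let $G$ carry the kinetic energy metric $$\langle X,Y\rangle_g=\int_M\langle\widetilde X(q),\widetilde Y(q)\rangle\,d\mu(q),\qquad X,Y\in T_gG,$$ where $\widetilde X(q)=\frac{d}{dt}\big|_0\,\gamma(t)\ast q$ for any smooth curve $\gamma$ in $G$ with $\gamma(0)=g$, $\gamma'(0)=X$. Let $K$ carry the metric induced from $G$ (which is bi-invariant). Let $\mathfrak m$ and $\mathfrak k$ be the Lie algebras of $M$ and $K$. Suppose that $Z\in\mathfrak k$ equals $\operatorname{diag}(X,0_n)$ or $\operatorname{diag}(0_n,X)$ with $X\in\mathfrak m$. Then the curve $\gamma(t)=\exp(tZ)$, $t\in\mathbb R$, which is a geodesic of $K$, is also a geodesic of $G$. -/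

import Mathlib

open MeasureTheory Matrix NormedSpace
open scoped ContDiff Quaternion

attribute [local instance] Matrix.frobeniusNormedAddCommGroup Matrix.frobeniusNormedSpace

noncomputable section

namespace Mobius

/-! ### Riemannian geometry of matrix Lie groups

`A` is an algebra of real, complex or quaternionic square matrices and `G ⊆ A` is (the set of
elements of) a closed group of invertible matrices.  The tangent space of `G` at `g` is
`{V * g | V ∈ lieAlg G}`.  A Riemannian metric on `G` is given by a function `m`, where `m g X Y`
is the inner product of the tangent vectors `X, Y` at `g`. -/

section Geodesics

variable {A : Type*} [Ring A] [TopologicalSpace A] [IsTopologicalRing A] [Module ℝ A]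

/-- The Lie algebra of a closed matrix group: all `X` whose one-parameter group lies in `G`. -/
def lieAlg (G : Set A) : Set A :=
  {X | ∀ t : ℝ, exp (t • X) ∈ G}

/-- The derivative at `g` of the function `f` in the direction of the right invariant vector
field `h ↦ V * h`, whose flow is `h ↦ exp (s • V) * h`. -/
def dirDeriv (V : A) (f : A → ℝ) (g : A) : ℝ :=
  deriv (fun s : ℝ => f (exp (s • V) * g)) 0

/-- The bracket of the right invariant vector fields `h ↦ V * h` and `h ↦ W * h` is the right
invariant vector field `h ↦ rbr V W * h`. -/
def rbr {A : Type*} [Ring A] (V W : A) : A := W * V - V * W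

/-- The right-hand side of the Koszul formula
`2⟨∇_V W, U⟩ = V⟨W,U⟩ + W⟨U,V⟩ - U⟨V,W⟩ + ⟨[V,W],U⟩ - ⟨[W,U],V⟩ + ⟨[U,V],W⟩`
at the point `g`, for the right invariant vector fields determined by `V, W, U`. -/
def koszul (m : A → A → A → ℝ) (g V W U : A) : ℝ :=
  dirDeriv V (fun h => m h (W * h) (U * h)) g
    + dirDeriv W (fun h => m h (U * h) (V * h)) g
    - dirDeriv U (fun h => m h (V * h) (W * h)) g
    + m g (rbr V W * g) (U * g)
    - m g (rbr W U * g) (V * g)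
    + m g (rbr U V * g) (W * g)

/-- `C * g` is the value at `g` of `∇_V W`, where `∇` is the Levi-Civita connection of `(G, m)`
and `V, W` stand for the right invariant vector fields which they determine. -/
def IsLeviCivita (G : Set A) (m : A → A → A → ℝ) (g V W C : A) : Prop :=
  C ∈ lieAlg G ∧ ∀ U ∈ lieAlg G, 2 * m g (C * g) (U * g) = koszul m g V W U

end Geodesics

variable {F : Type*} [NormedRing F] [NormedAlgebra ℝ F] {n : ℕ}

/-- The `2n × 2n` matrices, written in `n × n` blocks. -/
abbrev BMat (n : ℕ) (F : Type*) := Matrix (Fin n ⊕ Fin n) (Fin n ⊕ Fin n) F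

/-- A smooth curve `γ` in `G` is a geodesic of `(G, m)` if `∇_{γ'} γ' = 0`.  Writing
`γ' t = v t * γ t`, the covariant derivative of `γ'` along `γ` is `(v' t + C) * γ t`, where
`C * γ t` is the covariant derivative at `γ t` of the right invariant vector field of `v t` in its
own direction. -/
def IsGeodesic (G : Set (BMat n F)) (m : BMat n F → BMat n F → BMat n F → ℝ)
    (γ : ℝ → BMat n F) : Prop :=
  ContDiff ℝ ∞ γ ∧ (∀ t, γ t ∈ G) ∧
    ∃ v : ℝ → BMat n F, ContDiff ℝ ∞ v ∧
      (∀ t, v t ∈ lieAlg G ∧ HasDerivAt γ (v t * γ t) t) ∧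
      ∀ t, ∃ C, IsLeviCivita G m (γ t) (v t) (v t) C ∧ deriv v t + C = 0

/-! ### The Möbius action and the kinetic energy metric -/

/-- The Möbius action `(A B; C D) ∗ U = (A U + B) (C U + D)⁻¹`. -/
def mobius (g : BMat n F) (U : Matrix (Fin n) (Fin n) F) : Matrix (Fin n) (Fin n) F :=
  (g.toBlocks₁₁ * U + g.toBlocks₁₂) * Ring.inverse (g.toBlocks₂₁ * U + g.toBlocks₂₂)

/-- The velocity of `q` for the tangent vector `X` at `g`: the derivative of `γ t ∗ q` at `t = 0`
for any curve with `γ 0 = g` and `γ' 0 = X`. -/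
def velocity (g X : BMat n F) (q : Matrix (Fin n) (Fin n) F) : Matrix (Fin n) (Fin n) F :=
  fderiv ℝ (fun h : BMat n F => mobius h q) g X

/-- The real inner product `⟨X, Y⟩ = Re (tr (Xᴴ Y))` on matrices, as the sum over the entries of
the real inner product `Re (x̄ y)` of `ℝ`, `ℂ` or `ℍ`. -/
def frobInner [Inner ℝ F] (X Y : Matrix (Fin n) (Fin n) F) : ℝ :=
  ∑ i, ∑ j, inner ℝ (X i j) (Y i j)

/-- The dimension of a closed matrix group. -/
def dimGroup (M : Set (Matrix (Fin n) (Fin n) F)) : ℕ :=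
  Module.finrank ℝ (Submodule.span ℝ (lieAlg M))

/-- Matrices carry the Borel sigma-algebra. -/
@[reducible] def matrixBorel (n : ℕ) (F : Type*) [NormedRing F] :
    MeasurableSpace (Matrix (Fin n) (Fin n) F) := borel _

attribute [local instance] matrixBorel

/-- The Riemannian volume measure of the group `M`, for the metric induced by the inclusion in the
Euclidean space of matrices with the Frobenius norm: the Euclidean Hausdorff measure, in the
dimension of `M`, restricted to `M`. -/
def volumeMeasure (M : Set (Matrix (Fin n) (Fin n) F)) : Measure (Matrix (Fin n) (Fin n) F) :=
  haveI : @BorelSpace (Matrix (Fin n) (Fin n) F)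
      PseudoEMetricSpace.toUniformSpace.toTopologicalSpace (matrixBorel n F) := ⟨rfl⟩
  (Measure.euclideanHausdorffMeasure (dimGroup M)).restrict M

/-- The kinetic energy metric induced by the Möbius action on `M`, at the point `g`, evaluated on
the tangent vectors `X` and `Y` at `g`. -/
def kineticMetric [Inner ℝ F] (M : Set (Matrix (Fin n) (Fin n) F)) (g X Y : BMat n F) : ℝ :=
  ∫ q, frobInner (velocity g X q) (velocity g Y q) ∂(volumeMeasure M)

/-! ### The groups -/

/-- The group `U(n, n, F)` of matrices preserving the form `x̄ᵀ ξ - ȳᵀ η` on `Fⁿ × Fⁿ`. -/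
def splitU (n : ℕ) (F : Type*) [NormedRing F] [StarRing F] : Set (BMat n F) :=
  {g | gᴴ * fromBlocks 1 0 0 (-1) * g = fromBlocks 1 0 0 (-1)}

/-- The block diagonal matrices `diag(A, D)` with `A, D ∈ M`. -/
def blockProd (M : Set (Matrix (Fin n) (Fin n) F)) : Set (BMat n F) :=
  {g | ∃ A ∈ M, ∃ D ∈ M, g = fromBlocks A 0 0 D}

/-- `SO_n`. -/
def SOn (n : ℕ) : Set (Matrix (Fin n) (Fin n) ℝ) := specialOrthogonalGroup (Fin n) ℝ

/-- `U_n`. -/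
def Un (n : ℕ) : Set (Matrix (Fin n) (Fin n) ℂ) := unitaryGroup (Fin n) ℂ

/-- `Sp_n`. -/
def Spn (n : ℕ) : Set (Matrix (Fin n) (Fin n) ℍ[ℝ]) := unitary (Matrix (Fin n) (Fin n) ℍ[ℝ])

/-- `O_o(n, n)`, the identity component of `O(n, n)`. -/
def OoSplit (n : ℕ) : Set (BMat n ℝ) := connectedComponentIn (splitU n ℝ) 1

/-- `SU(n, n)`. -/
def SUSplit (n : ℕ) : Set (BMat n ℂ) := {g | g ∈ splitU n ℂ ∧ g.det = 1}

/-- `Sp(n, n)`. -/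
def SpSplit (n : ℕ) : Set (BMat n ℍ[ℝ]) := splitU n ℍ[ℝ]

/-- `SO_n × SO_n`. -/
def KReal (n : ℕ) : Set (BMat n ℝ) := blockProd (SOn n)

/-- `S(U_n × U_n)`. -/
def KComplex (n : ℕ) : Set (BMat n ℂ) := {g | g ∈ blockProd (Un n) ∧ g.det = 1}

/-- `Sp_n × Sp_n`. -/
def KQuat (n : ℕ) : Set (BMat n ℍ[ℝ]) := blockProd (Spn n)

end Mobius

end

open Mobius

/-! Along `exp (t • Z)` the velocity in the right-invariant frame is constantly `Z`, so it suffices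
that `∇_Z Z = 0` at the points of the curve, that is, that the Koszul expression with `V = W = Z`
vanishes for every `U` in the Lie algebra (`koszul_eq_zero`). By `velocity_mul` the right-invariant
field of `Y` moves `q` with velocity `mobiusField Y (h ∗ q)`, which turns each term into an integral
over `M`.

The derivatives along `Z` vanish because block diagonal elements act by `q ↦ a q dᴴ`, an isometry of
`M`; so the metric is constant along the curve in the right-invariant frame
(`kineticMetric_fromBlocks`). The derivative of `⟨Z, Z⟩` along `U` vanishes because `p ↦ X p` and `p
↦ -p Y` have constant length on unitary matrices, which the Möbius action preserves
(`frobInner_mobiusField_self`, `conjTranspose_mobius_mul_self`). This is where one block of `Z` must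
be zero. The bracket terms reduce to `∫ Re tr (B X q)` or `∫ Re tr (Y B q)`, and these are
derivatives of translation-invariant, hence constant, integrals (`integral_commutator`).

Additivity of `B ↦ ∫ Re tr (B q)` requires integrability, hence finiteness of the volume of `M`; the
Cayley transform provides it locally, and compactness globally. The argument uses only that `lieAlg
G ⊆ lieAlg (splitU n F)`, so it covers `K` and `G` at once. -/

noncomputable section

namespace Mobius

/-! ### The Frobenius norm as an algebra norm. -/

section FrobeniusRing

variable {F : Type*} [NormedRing F] {m : Type*} [Fintype m]

/-- Replacing entries by their norms reduces the claim to real matrices: this keeps the Frobenius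
norms of the factors and can only increase that of the product. -/
theorem frobenius_norm_mul_le (A B : Matrix m m F) : ‖A * B‖ ≤ ‖A‖ * ‖B‖ := by
  have h1 : ∀ C : Matrix m m F, ‖C‖ = ‖C.map (fun x => ‖x‖)‖ := fun C =>
    (frobenius_norm_map_eq C _ fun a => norm_norm a).symm
  rw [h1 A, h1 B]
  refine le_trans ?_ (Matrix.frobenius_norm_mul _ _)
  rw [frobenius_norm_def, frobenius_norm_def]
  gcongr with i _ j _
  simp only [Matrix.mul_apply, Matrix.map_apply]
  calc ‖∑ k, A i k * B k j‖ ≤ ∑ k, ‖A i k * B k j‖ := norm_sum_le _ _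
    _ ≤ ∑ k, ‖A i k‖ * ‖B k j‖ := Finset.sum_le_sum fun k _ => norm_mul_le _ _
    _ ≤ ‖∑ k, ‖A i k‖ * ‖B k j‖‖ := le_abs_self _

/-- The Frobenius norm on square matrices over a normed ring is submultiplicative. -/
@[reducible] def frobRing [DecidableEq m] : NormedRing (Matrix m m F) :=
  { Matrix.frobeniusNormedAddCommGroup, Matrix.instRing with
    norm_mul_le := frobenius_norm_mul_le }

attribute [local instance] frobRing

/-- Square matrices with the Frobenius norm form a normed algebra. -/
@[reducible] def frobAlgebra [DecidableEq m] [NormedAlgebra ℝ F] : NormedAlgebra ℝ (Matrix m m F) :=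
  { Matrix.frobeniusNormedSpace, Matrix.instAlgebra with }

theorem frobRing_completeSpace [CompleteSpace F] [DecidableEq m] :
    @CompleteSpace (Matrix m m F) (frobRing (F := F)).toMetricSpace.toUniformSpace :=
  Matrix.instCompleteSpace m m F

end FrobeniusRing

/-! ### Exponentials, and derivatives at the start of one-parameter groups. -/

section Exp

variable {A : Type*} [NormedRing A] [NormedAlgebra ℝ A]

theorem contDiff_exp_smul [CompleteSpace A] (X : A) :
    ContDiff ℝ ∞ fun t : ℝ => exp (t • X) := by
  have h : ContDiff ℝ ∞ (exp : A → A) :=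
    contDiff_iff_contDiffAt.2 fun x => (exp_analytic (𝕂 := ℝ) x).contDiffAt
  exact h.comp (contDiff_id.smul contDiff_const)

theorem exp_add_smul [CompleteSpace A] (s t : ℝ) (X : A) :
    exp ((s + t) • X) = exp (s • X) * exp (t • X) := by
  let _ := NormedAlgebra.restrictScalars ℚ ℝ A
  rw [add_smul, NormedSpace.exp_add_of_commute]
  exact ((Commute.refl X).smul_left s).smul_right t

theorem map_prod_exp [CompleteSpace A] {B : Type*} [NormedRing B] [NormedAlgebra ℝ B]
    (f : A × A →+* B) (hf : Continuous f) (X Y : A) : f (exp X, exp Y) = exp (f (X, Y)) := by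
  let _ := NormedAlgebra.restrictScalars ℚ ℝ A
  let _ := NormedAlgebra.restrictScalars ℚ ℝ B
  rw [← map_exp f hf]
  congr 1
  ext <;> simp

theorem star_eq_neg_of_exp_mem_unitary [CompleteSpace A] [StarRing A] [StarModule ℝ A]
    [ContinuousStar A] {X : A}
    (hX : ∀ t : ℝ, star (exp (t • X)) * exp (t • X) = 1) : star X = -X := by
  have h1 : HasDerivAt (fun t : ℝ => exp (t • X)) X 0 := by
    simpa using hasDerivAt_exp_smul_const (𝕂 := ℝ) X 0
  have h2 : HasDerivAt (fun t : ℝ => star (exp (t • X))) (star X) 0 := by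
    simpa [Function.comp_def] using
      ((starL' ℝ : A ≃L[ℝ] A).toContinuousLinearMap.hasFDerivAt.comp_hasDerivAt (0 : ℝ) h1)
  have h3 := h2.mul h1
  have h4 : HasDerivAt (fun t : ℝ => star (exp (t • X)) * exp (t • X)) 0 0 := by
    simpa only [hX] using hasDerivAt_const (0 : ℝ) (1 : A)
  have := h3.unique h4
  simp only [zero_smul, exp_zero, star_one, mul_one, one_mul] at this
  exact eq_neg_of_add_eq_zero_left this

/-- Differentiation of the invariance at `t = 0`. In the application `L` is `averageForm`. -/
theorem map_mul_eq_zero_of_map_mul_exp [FiniteDimensional ℝ A] (L : A →ₗ[ℝ] ℝ) {B X : A}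
    (h : ∀ t : ℝ, L (B * exp (t • X)) = L B) : L (B * X) = 0 := by
  have _ : CompleteSpace A := FiniteDimensional.complete ℝ A
  have h1 : HasDerivAt (fun t : ℝ => B * exp (t • X)) (B * X) 0 := by
    simpa using (hasDerivAt_exp_smul_const (𝕂 := ℝ) X 0).const_mul B
  have h2 : HasDerivAt (fun t : ℝ => L (B * exp (t • X))) (L (B * X)) 0 :=
    L.toContinuousLinearMap.hasFDerivAt.comp_hasDerivAt (0 : ℝ) h1
  simp only [h] at h2
  exact h2.unique (hasDerivAt_const _ _)

theorem map_mul_eq_zero_of_map_exp_mul [FiniteDimensional ℝ A] (L : A →ₗ[ℝ] ℝ) {B X : A}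
    (h : ∀ t : ℝ, L (exp (t • X) * B) = L B) : L (X * B) = 0 := by
  have _ : CompleteSpace A := FiniteDimensional.complete ℝ A
  have h1 : HasDerivAt (fun t : ℝ => exp (t • X) * B) (X * B) 0 := by
    simpa using (hasDerivAt_exp_smul_const (𝕂 := ℝ) X 0).mul_const B
  have h2 : HasDerivAt (fun t : ℝ => L (exp (t • X) * B)) (L (X * B)) 0 :=
    L.toContinuousLinearMap.hasFDerivAt.comp_hasDerivAt (0 : ℝ) h1
  simp only [h] at h2
  exact h2.unique (hasDerivAt_const _ _)

/-- The derivative of a quotient of linear maps into a normed algebra. -/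
theorem fderiv_mul_ringInverse [CompleteSpace A] {E : Type*} [NormedAddCommGroup E]
    [NormedSpace ℝ E] (N L : E →L[ℝ] A) {h : E} (hL : IsUnit (L h)) (V : E) :
    fderiv ℝ (fun g => N g * Ring.inverse (L g)) h V
      = N V * Ring.inverse (L h)
        - N h * (Ring.inverse (L h) * L V * Ring.inverse (L h)) := by
  obtain ⟨u, hu⟩ := hL
  have h1 := hasFDerivAt_ringInverse (𝕜 := ℝ) u
  rw [hu] at h1
  have h2 := (N.hasFDerivAt (x := h)).mul' (h1.comp h (L.hasFDerivAt (x := h)))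
  rw [show (fun g => N g * Ring.inverse (L g)) = (⇑N) * (Ring.inverse ∘ ⇑L) from rfl, h2.fderiv]
  simp [← hu]
  abel

end Exp

variable {F : Type*} [NormedRing F] [NormedAlgebra ℝ F] {n : ℕ}

section MatrixExp

variable [CompleteSpace F] {m : Type*} [Fintype m] [DecidableEq m]

theorem matrix_exp_add_smul (s t : ℝ) (X : Matrix m m F) :
    exp ((s + t) • X) = exp (s • X) * exp (t • X) := by
  let _ := frobRing (F := F) (m := m)
  let _ := frobAlgebra (F := F) (m := m)
  have _ := frobRing_completeSpace (F := F) (m := m)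
  exact exp_add_smul s t X

theorem matrix_contDiff_exp_smul (X : Matrix m m F) :
    ContDiff ℝ ∞ fun t : ℝ => exp (t • X) := by
  let _ := frobRing (F := F) (m := m)
  let _ := frobAlgebra (F := F) (m := m)
  have _ := frobRing_completeSpace (F := F) (m := m)
  exact contDiff_exp_smul X

theorem matrix_hasDerivAt_exp_smul (X : Matrix m m F) (t : ℝ) :
    HasDerivAt (fun t : ℝ => exp (t • X)) (X * exp (t • X)) t := by
  let _ := frobRing (F := F) (m := m)
  let _ := frobAlgebra (F := F) (m := m)
  have _ := frobRing_completeSpace (F := F) (m := m)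
  exact hasDerivAt_exp_smul_const' (𝕂 := ℝ) X t

theorem conjTranspose_eq_neg_of_exp [StarRing F] [StarModule ℝ F] [ContinuousStar F]
    {X : Matrix m m F} (hX : ∀ t : ℝ, (exp (t • X))ᴴ * exp (t • X) = 1) : Xᴴ = -X := by
  let _ := frobRing (F := F) (m := m)
  let _ := frobAlgebra (F := F) (m := m)
  have _ := frobRing_completeSpace (F := F) (m := m)
  have h0 := (inferInstance : ContinuousStar (Matrix m m F))
  have _ : @ContinuousStar (Matrix m m F)
      (frobRing (F := F)).toMetricSpace.toUniformSpace.toTopologicalSpace _ := h0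
  exact star_eq_neg_of_exp_mem_unitary hX

theorem exp_conjTranspose_mul_exp_of_skew [StarRing F] [StarModule ℝ F] [ContinuousStar F]
    {X : Matrix m m F}
    (hX : Xᴴ = -X) (t : ℝ) : (exp (t • X))ᴴ * exp (t • X) = 1 := by
  rw [← exp_conjTranspose, conjTranspose_smul, hX, star_trivial, smul_neg, ← neg_smul,
    ← matrix_exp_add_smul]
  simp

end MatrixExp

/-- The block diagonal embedding is a continuous ring homomorphism, so it commutes with `exp`. -/
theorem exp_smul_fromBlocks [CompleteSpace F] (t : ℝ) (X Y : Matrix (Fin n) (Fin n) F) :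
    exp (t • (fromBlocks X 0 0 Y : BMat n F)) = fromBlocks (exp (t • X)) 0 0 (exp (t • Y)) := by
  let f : Matrix (Fin n) (Fin n) F × Matrix (Fin n) (Fin n) F →+* BMat n F :=
    { toFun := fun p => fromBlocks p.1 0 0 p.2
      map_one' := fromBlocks_one
      map_zero' := fromBlocks_zero
      map_mul' := fun p q => by simp [fromBlocks_multiply]
      map_add' := fun p q => by simp [fromBlocks_add] }
  have hf : Continuous f :=
    Continuous.matrix_fromBlocks continuous_fst continuous_const continuous_const continuous_snd
  let _ := frobRing (F := F) (m := Fin n)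
  let _ := frobAlgebra (F := F) (m := Fin n)
  let _ := frobRing (F := F) (m := Fin n ⊕ Fin n)
  let _ := frobAlgebra (F := F) (m := Fin n ⊕ Fin n)
  have _ := frobRing_completeSpace (F := F) (m := Fin n)
  have h := map_prod_exp f hf (t • X) (t • Y)
  have h' : f (t • X, t • Y) = t • (fromBlocks X 0 0 Y : BMat n F) := by
    simp [f, fromBlocks_smul]
  rw [h'] at h
  exact h.symm

/-! ### Velocity fields of the Möbius action. -/

/-- The value at `p` of the vector field on matrices induced by the infinitesimal Möbius
transformation `Y`. -/
def mobiusField (Y : BMat n F) (p : Matrix (Fin n) (Fin n) F) : Matrix (Fin n) (Fin n) F :=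
  Y.toBlocks₁₁ * p + Y.toBlocks₁₂ - p * (Y.toBlocks₂₁ * p + Y.toBlocks₂₂)

/-- The numerator `A q + B` of the Möbius action, as a linear function of the matrix. -/
def mobiusNum (q : Matrix (Fin n) (Fin n) F) : BMat n F →ₗ[ℝ] Matrix (Fin n) (Fin n) F where
  toFun g := g.toBlocks₁₁ * q + g.toBlocks₁₂
  map_add' g h := by
    change (g.toBlocks₁₁ + h.toBlocks₁₁) * q + (g.toBlocks₁₂ + h.toBlocks₁₂) = _
    noncomm_ring
  map_smul' r g := by
    change (r • g.toBlocks₁₁) * q + r • g.toBlocks₁₂ = _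
    simp

/-- The denominator `C q + D` of the Möbius action, as a linear function of the matrix. -/
def mobiusDen (q : Matrix (Fin n) (Fin n) F) : BMat n F →ₗ[ℝ] Matrix (Fin n) (Fin n) F where
  toFun g := g.toBlocks₂₁ * q + g.toBlocks₂₂
  map_add' g h := by
    change (g.toBlocks₂₁ + h.toBlocks₂₁) * q + (g.toBlocks₂₂ + h.toBlocks₂₂) = _
    noncomm_ring
  map_smul' r g := by
    change (r • g.toBlocks₂₁) * q + r • g.toBlocks₂₂ = _
    simp

theorem mobiusNum_apply (q : Matrix (Fin n) (Fin n) F) (g : BMat n F) :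
    mobiusNum q g = g.toBlocks₁₁ * q + g.toBlocks₁₂ := rfl

theorem mobiusDen_apply (q : Matrix (Fin n) (Fin n) F) (g : BMat n F) :
    mobiusDen q g = g.toBlocks₂₁ * q + g.toBlocks₂₂ := rfl

theorem mobius_eq (g : BMat n F) (q : Matrix (Fin n) (Fin n) F) :
    mobius g q = mobiusNum q g * Ring.inverse (mobiusDen q g) := rfl

/-- Numerator and denominator form the column `h (q, 1)ᵀ`, on which `Y` acts by left multiplication.
-/
theorem mobiusNum_mul (Y h : BMat n F) (q : Matrix (Fin n) (Fin n) F) :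
    mobiusNum q (Y * h) = Y.toBlocks₁₁ * mobiusNum q h + Y.toBlocks₁₂ * mobiusDen q h := by
  rw [← fromBlocks_toBlocks Y, ← fromBlocks_toBlocks h, fromBlocks_multiply]
  simp only [mobiusNum_apply, mobiusDen_apply, toBlocks_fromBlocks₁₁, toBlocks_fromBlocks₁₂,
    toBlocks_fromBlocks₂₁, toBlocks_fromBlocks₂₂]
  noncomm_ring

theorem mobiusDen_mul (Y h : BMat n F) (q : Matrix (Fin n) (Fin n) F) :
    mobiusDen q (Y * h) = Y.toBlocks₂₁ * mobiusNum q h + Y.toBlocks₂₂ * mobiusDen q h := by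
  rw [← fromBlocks_toBlocks Y, ← fromBlocks_toBlocks h, fromBlocks_multiply]
  simp only [mobiusNum_apply, mobiusDen_apply, toBlocks_fromBlocks₁₁, toBlocks_fromBlocks₁₂,
    toBlocks_fromBlocks₂₁, toBlocks_fromBlocks₂₂]
  noncomm_ring

theorem velocity_eq [FiniteDimensional ℝ F] (h V : BMat n F) {q : Matrix (Fin n) (Fin n) F}
    (hq : IsUnit (mobiusDen q h)) :
    velocity h V q = mobiusNum q V * Ring.inverse (mobiusDen q h)
        - mobiusNum q h *
          (Ring.inverse (mobiusDen q h) * mobiusDen q V * Ring.inverse (mobiusDen q h)) := by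
  let _ := frobRing (F := F) (m := Fin n)
  let _ := frobAlgebra (F := F) (m := Fin n)
  have _ : CompleteSpace F := FiniteDimensional.complete ℝ F
  have _ := frobRing_completeSpace (F := F) (m := Fin n)
  have hfd : FiniteDimensional ℝ (BMat n F) := inferInstanceAs (FiniteDimensional ℝ (Matrix _ _ F))
  exact fderiv_mul_ringInverse (E := BMat n F) (mobiusNum q).toContinuousLinearMap
    (mobiusDen q).toContinuousLinearMap hq V

theorem velocity_mul [FiniteDimensional ℝ F] (Y h : BMat n F) {q : Matrix (Fin n) (Fin n) F}
    (hq : IsUnit (mobiusDen q h)) :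
    velocity h (Y * h) q = mobiusField Y (mobius h q) := by
  rw [velocity_eq h _ hq, mobiusField, mobius_eq, mobiusNum_mul, mobiusDen_mul]
  have h1 := Ring.mul_inverse_cancel _ hq
  set N := mobiusNum q h
  set D := mobiusDen q h
  set R := Ring.inverse D
  have h2 : Y.toBlocks₁₂ = Y.toBlocks₁₂ * (D * R) := by rw [h1, Matrix.mul_one]
  have h3 : Y.toBlocks₂₂ = Y.toBlocks₂₂ * (D * R) := by rw [h1, Matrix.mul_one]
  -- Inserting `D * R = 1` next to the constant blocks makes both sides agree as noncommutative
  -- polynomials in `N`, `D`, `R`.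
  conv_rhs => rw [h2, h3]
  noncomm_ring

/-- A real trace on a normed star ring which induces both the norm and the real inner product. -/
class RealTrace (F : Type*) [NormedRing F] [NormedAlgebra ℝ F] [StarRing F] [Inner ℝ F] where
  /-- The real part. -/
  re : F →ₗ[ℝ] ℝ
  inner_eq : ∀ x y : F, inner ℝ x y = re (star x * y)
  re_comm : ∀ x y : F, re (x * y) = re (y * x)
  re_star : ∀ x : F, re (star x) = re x
  norm_sq : ∀ x : F, ‖x‖ ^ 2 = re (star x * x)

instance : RealTrace ℝ where
  re := LinearMap.id
  inner_eq x y := by simp [mul_comm]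
  re_comm x y := by simp [mul_comm]
  re_star x := by simp
  norm_sq x := by simp [sq]

instance : RealTrace ℂ where
  re := Complex.reLm
  inner_eq x y := by simp [Complex.inner, mul_comm]
  re_comm x y := by simp [mul_comm]
  re_star x := by simp
  norm_sq x := by simp [← Complex.normSq_eq_norm_sq, Complex.normSq_apply]

instance : RealTrace ℍ[ℝ] where
  re := { toFun := fun x => x.re, map_add' := by simp, map_smul' := by simp }
  inner_eq x y := by
    change (x * star y).re = (star x * y).re
    simp
  re_comm x y := by
    change (x * y).re = (y * x).re
    simp only [Quaternion.re_mul]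
    ring
  re_star x := by
    change (star x).re = x.re
    simp
  norm_sq x := by
    change _ = (star x * x).re
    rw [sq, ← Quaternion.normSq_eq_norm_mul_self, ← Quaternion.inner_self, Quaternion.inner_def]
    simp

variable [StarRing F] [Inner ℝ F] [RealTrace F]

/-! ### The real trace form and unitary invariance of the norm. -/

section Trace

variable {m : Type*} [Fintype m]

/-- The real part of the trace of a square matrix. -/
def reTr : Matrix m m F →ₗ[ℝ] ℝ where
  toFun A := RealTrace.re (∑ i, A i i)
  map_add' A B := by simp [Finset.sum_add_distrib]
  map_smul' r A := by simp [← Finset.smul_sum]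

theorem reTr_mul_comm (A B : Matrix m m F) : reTr (A * B) = reTr (B * A) := by
  simp only [reTr, LinearMap.coe_mk, AddHom.coe_mk, Matrix.mul_apply, map_sum]
  rw [Finset.sum_comm]
  simp only [RealTrace.re_comm (A _ _)]

theorem reTr_conjTranspose (A : Matrix m m F) : reTr Aᴴ = reTr A := by
  simp [reTr, Matrix.conjTranspose_apply, RealTrace.re_star]

theorem frobenius_norm_sq (A : Matrix m m F) : ‖A‖ ^ 2 = reTr (Aᴴ * A) := by
  rw [frobenius_norm_def, ← Real.sqrt_eq_rpow, Real.sq_sqrt (by positivity)]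
  simp only [reTr, LinearMap.coe_mk, AddHom.coe_mk, Matrix.mul_apply, map_sum,
    Matrix.conjTranspose_apply, Real.rpow_two, RealTrace.norm_sq]
  rw [Finset.sum_comm]

theorem frobInner_eq_reTr (A B : Matrix (Fin n) (Fin n) F) : frobInner A B = reTr (Aᴴ * B) := by
  simp only [frobInner, reTr, LinearMap.coe_mk, AddHom.coe_mk, Matrix.mul_apply, map_sum,
    Matrix.conjTranspose_apply, RealTrace.inner_eq]
  rw [Finset.sum_comm]

variable [DecidableEq m]

theorem norm_mul_of_conjTranspose_mul_self {k : Matrix m m F} (hk : kᴴ * k = 1)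
    (q : Matrix m m F) : ‖k * q‖ = ‖q‖ := by
  rw [← sq_eq_sq₀ (norm_nonneg _) (norm_nonneg _), frobenius_norm_sq, frobenius_norm_sq,
    conjTranspose_mul, Matrix.mul_assoc, ← Matrix.mul_assoc kᴴ, hk, Matrix.one_mul]

theorem norm_mul_of_mul_conjTranspose_self {k : Matrix m m F} (hk : k * kᴴ = 1)
    (q : Matrix m m F) : ‖q * k‖ = ‖q‖ := by
  rw [← sq_eq_sq₀ (norm_nonneg _) (norm_nonneg _), frobenius_norm_sq, frobenius_norm_sq,
    conjTranspose_mul, Matrix.mul_assoc, reTr_mul_comm, Matrix.mul_assoc, Matrix.mul_assoc,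
    hk, Matrix.mul_one]

end Trace
-- Local finiteness of the Hausdorff measure on unitary elements.
section Cayley

open Topology

/-- Clearing the denominators on both sides reduces skewness to `(p* - 1)(p + 1) = -(p* + 1)(p -
1)`, which follows from `p* p = 1`. -/
theorem cayley_skew {A : Type*} [Ring A] [StarRing A] {p : A}
    (hp : star p * p = 1) (hu : IsUnit (p + 1)) :
    star ((p - 1) * Ring.inverse (p + 1)) = -((p - 1) * Ring.inverse (p + 1)) := by
  have h1 := Ring.mul_inverse_cancel _ hu
  set u := Ring.inverse (p + 1)
  have h2 : star u * (star p + 1) = 1 := by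
    rw [← star_one A, ← star_add, ← star_mul, h1]
  have h3 : (star p - 1) * (p + 1) = -((star p + 1) * (p - 1)) := by
    simp only [mul_add, mul_sub, add_mul, sub_mul, hp]
    noncomm_ring
  calc star ((p - 1) * u) = star u * ((star p - 1) * (p + 1)) * u := by
        rw [star_mul, star_sub, star_one, mul_assoc, mul_assoc, h1, mul_one]
    _ = -(star u * (star p + 1) * (p - 1) * u) := by rw [h3]; noncomm_ring
    _ = _ := by rw [h2, one_mul]

/-- Near the identity, the unitary elements are a Lipschitz image, under the Cayley transform, of
a bounded set of skew elements, and so have finite Hausdorff measure. -/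
theorem exists_nhds_one_hausdorffMeasure_lt_top {A : Type*} [NormedRing A]
    [NormedAlgebra ℝ A] [StarRing A] [FiniteDimensional ℝ A] [MeasurableSpace A] [BorelSpace A]
    (W : Submodule ℝ A) (hW : ∀ S : A, star S = -S → S ∈ W) :
    ∃ V ∈ 𝓝 (1 : A),
      Measure.euclideanHausdorffMeasure (Module.finrank ℝ W) {p ∈ V | star p * p = 1} < ⊤ := by
  have _ : CompleteSpace A := FiniteDimensional.complete ℝ A
  -- `c` is the Cayley transform and `f` its inverse. As `f` is `C¹` at `0`, it is Lipschitz on a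
  -- neighbourhood `t`; the unit ball makes `1 - c p` invertible.
  let f : A → A := fun S => (1 + S) * Ring.inverse (1 - S)
  let c : A → A := fun p => (p - 1) * Ring.inverse (p + 1)
  have hf : ContDiffAt ℝ 1 f 0 := by
    refine (contDiffAt_const.add contDiffAt_id).mul ?_
    have h1 : ContDiffAt ℝ 1 Ring.inverse (1 - (0 : A)) := by
      simpa using contDiffAt_ringInverse ℝ (1 : Aˣ)
    exact h1.comp (0 : A) (contDiffAt_const.sub contDiffAt_id)
  obtain ⟨K, t, ht, hK⟩ := hf.exists_lipschitzOnWith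
  have h2 : IsUnit ((1 : A) + 1) := by
    simpa only [map_add, map_one] using
      (IsUnit.mk0 ((1 : ℝ) + 1) (by norm_num)).map (algebraMap ℝ A)
  have hc : ContinuousAt c 1 := by
    obtain ⟨u, hu⟩ := h2
    have h3 : ContinuousAt Ring.inverse ((1 : A) + 1) := hu ▸ NormedRing.inverse_continuousAt u
    exact (continuousAt_id.sub continuousAt_const).mul
      (ContinuousAt.comp (f := fun p : A => p + 1) h3 (continuousAt_id.add continuousAt_const))
  have hc1 : c 1 = 0 := by simp [c]
  have hV : c ⁻¹' (t ∩ Metric.ball 0 1) ∩ {p | IsUnit (p + 1)} ∈ 𝓝 (1 : A) := by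
    refine Filter.inter_mem (hc.preimage_mem_nhds ?_) ?_
    · rw [hc1]
      exact Filter.inter_mem ht (Metric.ball_mem_nhds _ one_pos)
    · exact (continuousAt_id.add continuousAt_const).preimage_mem_nhds
        (Units.isOpen.mem_nhds h2)
  refine ⟨_, hV, ?_⟩
  have hsub : {p ∈ c ⁻¹' (t ∩ Metric.ball 0 1) ∩ {p | IsUnit (p + 1)} | star p * p = 1}
      ⊆ f '' (t ∩ W.subtype '' Metric.ball 0 1) := by
    rintro p ⟨⟨⟨hpt, hpb⟩, hpu⟩, hp⟩
    have hnorm : ‖c p‖ < 1 := by simpa using hpb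
    refine ⟨c p, ⟨hpt, ⟨c p, hW _ (cayley_skew hp hpu)⟩, by simpa using hnorm, rfl⟩, ?_⟩
    have h4 : p * (1 - c p) = 1 + c p := by
      have h5 := Ring.mul_inverse_cancel _ hpu
      calc p * (1 - c p) = p * ((p + 1) * Ring.inverse (p + 1)
            - (p - 1) * Ring.inverse (p + 1)) := by rw [h5]
        _ = (p + 1) * Ring.inverse (p + 1) + (p - 1) * Ring.inverse (p + 1) := by noncomm_ring
        _ = 1 + c p := by rw [h5]
    change (1 + c p) * Ring.inverse (1 - c p) = p
    rw [← h4, mul_assoc, Ring.mul_inverse_cancel _ (isUnit_one_sub_of_norm_lt_one hnorm), mul_one]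
  have hball : μH[Module.finrank ℝ W] (W.subtype '' Metric.ball 0 1) < ⊤ := by
    have hi : Isometry W.subtype := isometry_subtype_coe
    rw [hi.hausdorffMeasure_image (Or.inl (Nat.cast_nonneg _))]
    exact measure_ball_lt_top
  have hfin : μH[Module.finrank ℝ W] (f '' (t ∩ W.subtype '' Metric.ball 0 1)) < ⊤ := by
    refine ((hK.mono Set.inter_subset_left).hausdorffMeasure_image_le
      (Nat.cast_nonneg _)).trans_lt ?_
    refine ENNReal.mul_lt_top (ENNReal.rpow_lt_top_of_nonneg (Nat.cast_nonneg _) (by simp)) ?_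
    exact (measure_mono Set.inter_subset_right).trans_lt hball
  rw [Measure.euclideanHausdorffMeasure_def, Measure.smul_apply]
  exact ENNReal.mul_lt_top (by simp) ((measure_mono hsub).trans_lt hfin)

end Cayley


/-! ### Möbius transformations of unitary matrices. -/

section Unitary

theorem isUnit_of_mul_eq_zero {A : Type*} [Ring A] [Algebra ℝ A] [FiniteDimensional ℝ A] {L : A}
    (h : ∀ x, L * x = 0 → x = 0) : IsUnit L := by
  have hinj : Function.Injective (LinearMap.mulLeft ℝ L) :=
    (injective_iff_map_eq_zero _).2 fun x hx => h x hx
  obtain ⟨y, hy⟩ := LinearMap.injective_iff_surjective.1 hinj 1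
  have hy : L * y = 1 := hy
  -- The right inverse is also a left inverse, since `L * (y * L - 1) = 0`.
  refine ⟨⟨L, y, hy, sub_eq_zero.1 (h _ ?_)⟩, rfl⟩
  rw [mul_sub, ← mul_assoc, hy, one_mul, mul_one, sub_self]

theorem splitU_blocks {F : Type*} [NormedRing F] [StarRing F]
    {h : BMat n F} (hh : h ∈ splitU n F) :
    h.toBlocks₁₁ᴴ * h.toBlocks₁₁ - h.toBlocks₂₁ᴴ * h.toBlocks₂₁ = 1 ∧
    h.toBlocks₁₁ᴴ * h.toBlocks₁₂ - h.toBlocks₂₁ᴴ * h.toBlocks₂₂ = 0 ∧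
    h.toBlocks₁₂ᴴ * h.toBlocks₁₁ - h.toBlocks₂₂ᴴ * h.toBlocks₂₁ = 0 ∧
    h.toBlocks₁₂ᴴ * h.toBlocks₁₂ - h.toBlocks₂₂ᴴ * h.toBlocks₂₂ = -1 := by
  have hh : hᴴ * fromBlocks 1 0 0 (-1) * h = fromBlocks 1 0 0 (-1) := hh
  rw [← fromBlocks_toBlocks h, fromBlocks_conjTranspose, fromBlocks_multiply,
    fromBlocks_multiply, fromBlocks_inj] at hh
  simpa [sub_eq_add_neg] using hh

/-- The columns of `(q, 1)ᵀ` span an isotropic subspace when `q` is unitary, and `h` preserves the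
form. -/
theorem conjTranspose_mobiusNum_mul_self {F : Type*} [NormedRing F] [NormedAlgebra ℝ F] [StarRing F]
    {h : BMat n F} (hh : h ∈ splitU n F)
    {q : Matrix (Fin n) (Fin n) F} (hq : qᴴ * q = 1) :
    (mobiusNum q h)ᴴ * mobiusNum q h = (mobiusDen q h)ᴴ * mobiusDen q h := by
  obtain ⟨h1, h2, h3, h4⟩ := splitU_blocks hh
  rw [← sub_eq_zero, mobiusNum_apply, mobiusDen_apply]
  set a := h.toBlocks₁₁
  set b := h.toBlocks₁₂
  set c := h.toBlocks₂₁
  set d := h.toBlocks₂₂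
  calc (a * q + b)ᴴ * (a * q + b) - (c * q + d)ᴴ * (c * q + d)
      = qᴴ * (aᴴ * a - cᴴ * c) * q + qᴴ * (aᴴ * b - cᴴ * d) + (bᴴ * a - dᴴ * c) * q
        + (bᴴ * b - dᴴ * d) := by
        simp only [conjTranspose_add, conjTranspose_mul]
        noncomm_ring
    _ = 0 := by rw [h1, h2, h3, h4]; simp [hq]

theorem isUnit_mobiusDen [FiniteDimensional ℝ F] {h : BMat n F} (hh : h ∈ splitU n F)
    {q : Matrix (Fin n) (Fin n) F} (hq : qᴴ * q = 1) : IsUnit (mobiusDen q h) := by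
  refine isUnit_of_mul_eq_zero fun x hx => ?_
  have hN : mobiusNum q h * x = 0 := by
    rw [← norm_eq_zero, ← sq_eq_zero_iff, frobenius_norm_sq, conjTranspose_mul, Matrix.mul_assoc,
      ← Matrix.mul_assoc _ _ x, conjTranspose_mobiusNum_mul_self hh hq, Matrix.mul_assoc, hx]
    simp
  obtain ⟨-, -, h3, h4⟩ := splitU_blocks hh
  -- This is the lower row of `h⁻¹ (h (q, 1)ᵀ) = (q, 1)ᵀ`, the form giving `h⁻¹` in terms of `hᴴ`. A
  -- vector killed by both numerator and denominator is therefore zero.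
  have key : h.toBlocks₂₂ᴴ * mobiusDen q h - h.toBlocks₁₂ᴴ * mobiusNum q h = 1 := by
    rw [mobiusNum_apply, mobiusDen_apply]
    calc _ = -(h.toBlocks₁₂ᴴ * h.toBlocks₁₁ - h.toBlocks₂₂ᴴ * h.toBlocks₂₁) * q
          - (h.toBlocks₁₂ᴴ * h.toBlocks₁₂ - h.toBlocks₂₂ᴴ * h.toBlocks₂₂) := by noncomm_ring
      _ = 1 := by rw [h3, h4]; simp
  rw [← Matrix.one_mul x, ← key, Matrix.sub_mul, Matrix.mul_assoc, Matrix.mul_assoc, hx, hN]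
  simp

theorem conjTranspose_mobius_mul_self [FiniteDimensional ℝ F] {h : BMat n F}
    (hh : h ∈ splitU n F) {q : Matrix (Fin n) (Fin n) F} (hq : qᴴ * q = 1) :
    (mobius h q)ᴴ * mobius h q = 1 := by
  have h1 := Ring.mul_inverse_cancel _ (isUnit_mobiusDen hh hq)
  rw [mobius_eq, conjTranspose_mul, Matrix.mul_assoc, ← Matrix.mul_assoc _ _ (Ring.inverse _),
    conjTranspose_mobiusNum_mul_self hh hq, Matrix.mul_assoc, h1, Matrix.mul_one,
    ← conjTranspose_mul, h1, conjTranspose_one]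

theorem mul_conjTranspose_self {F : Type*} [NormedRing F] [NormedAlgebra ℝ F] [StarRing F]
    [FiniteDimensional ℝ F] {p : Matrix (Fin n) (Fin n) F}
    (hp : pᴴ * p = 1) : p * pᴴ = 1 := by
  have h : IsUnit p := isUnit_of_mul_eq_zero fun x hx => by
    rw [← Matrix.one_mul x, ← hp, Matrix.mul_assoc, hx, Matrix.mul_zero]
  obtain ⟨u, rfl⟩ := h
  have h' : (u : Matrix (Fin n) (Fin n) F)ᴴ = ↑u⁻¹ := Units.eq_inv_of_mul_eq_one_right hp
  rw [h', u.mul_inv]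

theorem fromBlocks_mem_splitU {F : Type*} [NormedRing F] [StarRing F]
    {a d : Matrix (Fin n) (Fin n) F} (ha : aᴴ * a = 1) (hd : dᴴ * d = 1) :
    fromBlocks a 0 0 d ∈ splitU n F := by
  change _ * _ * _ = _
  simp [fromBlocks_conjTranspose, fromBlocks_multiply, ha, hd]

theorem mul_mem_splitU {F : Type*} [NormedRing F] [StarRing F] {g h : BMat n F}
    (hg : g ∈ splitU n F) (hh : h ∈ splitU n F) : g * h ∈ splitU n F := by
  have hg : gᴴ * fromBlocks 1 0 0 (-1) * g = fromBlocks 1 0 0 (-1) := hg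
  have hh : hᴴ * fromBlocks 1 0 0 (-1) * h = fromBlocks 1 0 0 (-1) := hh
  change (g * h)ᴴ * fromBlocks 1 0 0 (-1) * (g * h) = fromBlocks 1 0 0 (-1)
  rw [conjTranspose_mul]
  calc _ = hᴴ * (gᴴ * fromBlocks 1 0 0 (-1) * g) * h := by noncomm_ring
    _ = _ := by rw [hg, hh]

theorem mobius_fromBlocks {F : Type*} [NormedRing F] [NormedAlgebra ℝ F] [StarRing F]
    [FiniteDimensional ℝ F] (a : Matrix (Fin n) (Fin n) F)
    {d : Matrix (Fin n) (Fin n) F} (hd : dᴴ * d = 1) (q : Matrix (Fin n) (Fin n) F) :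
    mobius (fromBlocks a 0 0 d) q = a * q * dᴴ := by
  have h : Ring.inverse d = dᴴ :=
    Ring.inverse_unit (⟨d, dᴴ, mul_conjTranspose_self hd, hd⟩ : (Matrix (Fin n) (Fin n) F)ˣ)
  simp [mobius, h]

theorem mobiusField_fromBlocks {F : Type*} [NormedRing F]
    (X Y p : Matrix (Fin n) (Fin n) F) :
    mobiusField (fromBlocks X 0 0 Y) p = X * p - p * Y := by
  simp [mobiusField]

/-- The vector fields `p ↦ X p` and `p ↦ -p Y` have constant length on the unitary matrices. -/
theorem frobInner_mobiusField_self [FiniteDimensional ℝ F] {X Y : Matrix (Fin n) (Fin n) F}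
    (hXY : X = 0 ∨ Y = 0) {p : Matrix (Fin n) (Fin n) F} (hp : pᴴ * p = 1) :
    frobInner (mobiusField (fromBlocks X 0 0 Y) p) (mobiusField (fromBlocks X 0 0 Y) p)
      = reTr (Xᴴ * X) + reTr (Yᴴ * Y) := by
  rw [mobiusField_fromBlocks, frobInner_eq_reTr, ← frobenius_norm_sq, ← frobenius_norm_sq,
    ← frobenius_norm_sq]
  rcases hXY with rfl | rfl
  · simp [norm_mul_of_conjTranspose_mul_self hp]
  · simp [norm_mul_of_mul_conjTranspose_self (mul_conjTranspose_self hp)]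

/-- The `a` contributions cancel by cyclicity of the trace, and `d` does not occur. Taking the
adjoint of the `c` term makes it linear in `q`, like the `b` term, which leaves the shape `Re tr (B
X q)`. -/
theorem frobInner_mobiusField_commutator_left {X : Matrix (Fin n) (Fin n) F} (hX : Xᴴ = -X)
    (U : BMat n F) {q : Matrix (Fin n) (Fin n) F} (hq : q * qᴴ = 1) :
    frobInner (mobiusField (fromBlocks X 0 0 0 * U - U * fromBlocks X 0 0 0) q)
        (mobiusField (fromBlocks X 0 0 0) q)
      = reTr (-((U.toBlocks₁₂ᴴ + U.toBlocks₂₁) * X) * (X * q)) := by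
  rw [← fromBlocks_toBlocks U]
  simp only [toBlocks_fromBlocks₁₂, toBlocks_fromBlocks₂₁]
  set a := U.toBlocks₁₁
  set b := U.toBlocks₁₂
  set c := U.toBlocks₂₁
  set d := U.toBlocks₂₂
  have e : mobiusField (fromBlocks X 0 0 0 * fromBlocks a b c d
      - fromBlocks a b c d * fromBlocks X 0 0 0) q
      = (X * a - a * X) * q + X * b + q * (c * X * q) := by
    rw [fromBlocks_multiply, fromBlocks_multiply, sub_eq_add_neg, fromBlocks_neg, fromBlocks_add]
    simp [mobiusField, sub_eq_add_neg]
  have hconj : ∀ W : Matrix (Fin n) (Fin n) F, reTr (qᴴ * W * q) = reTr W := fun W => by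
    rw [reTr_mul_comm, ← Matrix.mul_assoc, hq, Matrix.one_mul]
  have h1 : reTr (X * aᴴ * X) = reTr (aᴴ * X * X) := by
    rw [Matrix.mul_assoc, reTr_mul_comm]
  have h2 : reTr (X * cᴴ * qᴴ * X) = reTr (c * X * X * q) := by
    rw [← reTr_conjTranspose]
    simp only [conjTranspose_mul, conjTranspose_conjTranspose, hX]
    rw [show -X * (q * (c * -X)) = (X * q) * (c * X) by noncomm_ring, reTr_mul_comm]
    simp only [Matrix.mul_assoc]
  have h3 : ((X * a - a * X) * q + X * b + q * (c * X * q))ᴴ * (X * q)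
      = -(qᴴ * (aᴴ * X * X) * q) + qᴴ * (X * aᴴ * X) * q - bᴴ * X * X * q
        - qᴴ * (X * cᴴ * qᴴ * X) * q := by
    simp only [conjTranspose_add, conjTranspose_sub, conjTranspose_mul, hX]
    noncomm_ring
  have h4 : -((bᴴ + c) * X) * (X * q) = -(bᴴ * X * X * q) - c * X * X * q := by noncomm_ring
  rw [e, mobiusField_fromBlocks, Matrix.mul_zero, sub_zero, frobInner_eq_reTr, h3, h4]
  simp only [map_add, map_sub, map_neg, hconj, h1, h2]
  ring

/-- Mirror image of the left case: now `d` cancels and `a` is absent. Cyclicity brings the result to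
the shape `Re tr (Y B q)`. -/
theorem frobInner_mobiusField_commutator_right {Y : Matrix (Fin n) (Fin n) F} (hY : Yᴴ = -Y)
    (U : BMat n F) {q : Matrix (Fin n) (Fin n) F} (hq : qᴴ * q = 1) :
    frobInner (mobiusField (fromBlocks 0 0 0 Y * U - U * fromBlocks 0 0 0 Y) q)
        (mobiusField (fromBlocks 0 0 0 Y) q)
      = reTr (-(Y * (U.toBlocks₁₂ᴴ + U.toBlocks₂₁)) * (q * Y)) := by
  rw [← fromBlocks_toBlocks U]
  simp only [toBlocks_fromBlocks₁₂, toBlocks_fromBlocks₂₁]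
  set a := U.toBlocks₁₁
  set b := U.toBlocks₁₂
  set c := U.toBlocks₂₁
  set d := U.toBlocks₂₂
  have e : mobiusField (fromBlocks 0 0 0 Y * fromBlocks a b c d
      - fromBlocks a b c d * fromBlocks 0 0 0 Y) q
      = -(b * Y + q * (Y * c * q) + q * (Y * d - d * Y)) := by
    rw [fromBlocks_multiply, fromBlocks_multiply, sub_eq_add_neg, fromBlocks_neg, fromBlocks_add]
    simp only [mobiusField, toBlocks_fromBlocks₁₁, toBlocks_fromBlocks₁₂, toBlocks_fromBlocks₂₁,
      toBlocks_fromBlocks₂₂]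
    noncomm_ring
  have h1 : reTr (Y * dᴴ * Y) = reTr (dᴴ * Y * Y) := by
    rw [Matrix.mul_assoc, reTr_mul_comm]
  have h2 : reTr (qᴴ * cᴴ * Y * Y) = reTr (Y * c * q * Y) := by
    rw [← reTr_conjTranspose]
    simp only [conjTranspose_mul, conjTranspose_conjTranspose, hY]
    rw [show -Y * (-Y * (c * q)) = Y * (Y * c * q) by noncomm_ring, reTr_mul_comm]
  have h3 : (-(b * Y + q * (Y * c * q) + q * (Y * d - d * Y)))ᴴ * (-(q * Y))
      = -(Y * bᴴ * q * Y) - qᴴ * cᴴ * Y * (qᴴ * q) * Y - dᴴ * Y * (qᴴ * q) * Y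
        + Y * dᴴ * (qᴴ * q) * Y := by
    simp only [conjTranspose_add, conjTranspose_sub, conjTranspose_mul, conjTranspose_neg, hY]
    noncomm_ring
  have h4 : -(Y * (bᴴ + c)) * (q * Y) = -(Y * bᴴ * q * Y) - Y * c * q * Y := by noncomm_ring
  rw [e, mobiusField_fromBlocks, Matrix.zero_mul, zero_sub, frobInner_eq_reTr, h3, h4, hq]
  simp only [map_add, map_sub, map_neg, Matrix.mul_one, h1, h2]
  ring

end Unitary

/-! ### Invariant integration over `M` and the Koszul formula. -/

section Volume

attribute [local instance] matrixBorel

/-- A closed group of unitary matrices whose Lie algebra contains every skew-Hermitian matrix. -/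
structure IsFullUnitaryGroup (M : Set (Matrix (Fin n) (Fin n) F)) : Prop where
  one_mem : 1 ∈ M
  mul_mem : ∀ {p q}, p ∈ M → q ∈ M → p * q ∈ M
  conjTranspose_mem : ∀ {p}, p ∈ M → pᴴ ∈ M
  conjTranspose_mul : ∀ {p}, p ∈ M → pᴴ * p = 1
  isClosed : IsClosed M
  skew_mem : ∀ {S : Matrix (Fin n) (Fin n) F}, Sᴴ = -S → S ∈ lieAlg M

theorem matrix_borelSpace {F : Type*} [NormedRing F] : @BorelSpace (Matrix (Fin n) (Fin n) F)
    PseudoEMetricSpace.toUniformSpace.toTopologicalSpace (matrixBorel n F) := ⟨rfl⟩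

theorem matrix_borelSpace' {F : Type*} [NormedRing F] :
    BorelSpace (Matrix (Fin n) (Fin n) F) := ⟨rfl⟩

attribute [local instance] matrix_borelSpace matrix_borelSpace'

variable {M : Set (Matrix (Fin n) (Fin n) F)}

/-- The isometry `q ↦ a q dᴴ` for unitary `a, d`. -/
def twoSidedMul (a d : Matrix (Fin n) (Fin n) F) (ha : aᴴ * a = 1) (ha' : a * aᴴ = 1)
    (hd : dᴴ * d = 1) (hd' : d * dᴴ = 1) :
    Matrix (Fin n) (Fin n) F ≃ᵢ Matrix (Fin n) (Fin n) F where
  toFun q := a * q * dᴴ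
  invFun q := aᴴ * q * d
  left_inv q := by
    beta_reduce
    rw [show aᴴ * (a * q * dᴴ) * d = (aᴴ * a) * q * (dᴴ * d) by noncomm_ring, ha, hd]
    simp
  right_inv q := by
    beta_reduce
    rw [show a * (aᴴ * q * d) * dᴴ = (a * aᴴ) * q * (d * dᴴ) by noncomm_ring, ha', hd']
    simp
  isometry_toFun := Isometry.of_dist_eq fun x y => by
    rw [dist_eq_norm, dist_eq_norm, ← Matrix.sub_mul, ← Matrix.mul_sub,
      norm_mul_of_mul_conjTranspose_self (by simpa using hd),
      norm_mul_of_conjTranspose_mul_self ha]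

namespace IsFullUnitaryGroup

theorem mul_conjTranspose {F : Type*} [NormedRing F] [NormedAlgebra ℝ F] [StarRing F]
    {M : Set (Matrix (Fin n) (Fin n) F)} (hM : IsFullUnitaryGroup M)
    {p : Matrix (Fin n) (Fin n) F} (hp : p ∈ M) : p * pᴴ = 1 := by
  simpa using hM.conjTranspose_mul (hM.conjTranspose_mem hp)

theorem measurableSet {F : Type*} [NormedRing F] [NormedAlgebra ℝ F] [StarRing F]
    {M : Set (Matrix (Fin n) (Fin n) F)} (hM : IsFullUnitaryGroup M) : MeasurableSet M :=
  hM.isClosed.measurableSet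

theorem ae_mem {F : Type*} [NormedRing F] [NormedAlgebra ℝ F] [StarRing F]
    {M : Set (Matrix (Fin n) (Fin n) F)} (hM : IsFullUnitaryGroup M) : ∀ᵐ q ∂volumeMeasure M, q ∈ M :=
  ae_restrict_mem hM.measurableSet

/-- An isometry of the ambient matrix space that maps `M` onto itself preserves Hausdorff measure on
`M`. -/
theorem integral_mul_mul (hM : IsFullUnitaryGroup M) {a d : Matrix (Fin n) (Fin n) F}
    (ha : a ∈ M) (hd : d ∈ M) {E : Type*} [NormedAddCommGroup E] [NormedSpace ℝ E]
    (f : Matrix (Fin n) (Fin n) F → E) :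
    ∫ q, f (a * q * dᴴ) ∂volumeMeasure M = ∫ q, f q ∂volumeMeasure M := by
  let e := twoSidedMul a d (hM.conjTranspose_mul ha) (hM.mul_conjTranspose ha)
    (hM.conjTranspose_mul hd) (hM.mul_conjTranspose hd)
  have hpre : e ⁻¹' M = M := by
    ext q
    refine ⟨fun hq => ?_, fun hq => hM.mul_mem (hM.mul_mem ha hq) (hM.conjTranspose_mem hd)⟩
    rw [← e.symm_apply_apply q]
    exact hM.mul_mem (hM.mul_mem (hM.conjTranspose_mem ha) hq) hd
  have h1 := (e.measurePreserving_euclideanHausdorffMeasure (dimGroup M)).restrict_preimage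
    hM.measurableSet
  rw [hpre] at h1
  exact h1.integral_comp e.toHomeomorph.measurableEmbedding f

theorem isCompact [FiniteDimensional ℝ F] (hM : IsFullUnitaryGroup M) : IsCompact M := by
  have _ : FiniteDimensional ℝ (Matrix (Fin n) (Fin n) F) := inferInstance
  have _ : ProperSpace (Matrix (Fin n) (Fin n) F) := FiniteDimensional.proper ℝ _
  refine Metric.isCompact_of_isClosed_isBounded hM.isClosed
    (isBounded_iff_forall_norm_le.2 ⟨‖(1 : Matrix (Fin n) (Fin n) F)‖, fun p hp => ?_⟩)
  rw [← norm_mul_of_conjTranspose_mul_self (hM.conjTranspose_mul hp) 1, Matrix.mul_one]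

theorem exists_nhds_one {F : Type*} [NormedRing F] [NormedAlgebra ℝ F] [StarRing F]
    [FiniteDimensional ℝ F] {M : Set (Matrix (Fin n) (Fin n) F)} (hM : IsFullUnitaryGroup M) :
    ∃ V ∈ nhds (1 : Matrix (Fin n) (Fin n) F),
      Measure.euclideanHausdorffMeasure (dimGroup M) {p ∈ V | pᴴ * p = 1} < ⊤ := by
  let _ := frobRing (F := F) (m := Fin n)
  let _ := frobAlgebra (F := F) (m := Fin n)
  exact exists_nhds_one_hausdorffMeasure_lt_top (A := Matrix (Fin n) (Fin n) F)
    -- `skew_mem` ensures that the dimension used for the volume is large enough for the skew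
    -- matrices that parametrize a neighbourhood of `1`.
    (Submodule.span ℝ (lieAlg M)) fun S hS => Submodule.subset_span (hM.skew_mem hS)

theorem isFiniteMeasure [FiniteDimensional ℝ F] (hM : IsFullUnitaryGroup M) :
    IsFiniteMeasure (volumeMeasure M) := by
  obtain ⟨V, hV, hfin⟩ := hM.exists_nhds_one
  refine ⟨?_⟩
  rw [volumeMeasure, Measure.restrict_apply_univ]
  refine hM.isCompact.measure_lt_top_of_nhdsWithin fun p hp => ?_
  have hp' := hM.conjTranspose_mem hp
  -- Left translation by `pᴴ` carries the finite-measure neighbourhood of `1` to one of `p`.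
  let e := twoSidedMul pᴴ 1 (hM.conjTranspose_mul hp') (hM.mul_conjTranspose hp')
    (by simp) (by simp)
  have he : ∀ q, e q = pᴴ * q := fun q => by
    change pᴴ * q * 1ᴴ = _
    simp
  refine ⟨e ⁻¹' {p ∈ V | pᴴ * p = 1}, ?_, ?_⟩
  · have h1 : e ⁻¹' V ∈ nhds p := by
      refine e.continuous.continuousAt.preimage_mem_nhds ?_
      rwa [he, hM.conjTranspose_mul hp]
    filter_upwards [mem_nhdsWithin_of_mem_nhds h1, self_mem_nhdsWithin] with q hq hqM
    exact ⟨hq, by rw [he]; exact hM.conjTranspose_mul (hM.mul_mem hp' hqM)⟩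
  · rwa [(e.measurePreserving_euclideanHausdorffMeasure (dimGroup M)).measure_preimage_emb
      e.toHomeomorph.measurableEmbedding]

theorem integrable_reTr_mul [FiniteDimensional ℝ F] (hM : IsFullUnitaryGroup M)
    (B : Matrix (Fin n) (Fin n) F) : Integrable (fun q => reTr (B * q)) (volumeMeasure M) := by
  have _ := hM.isFiniteMeasure
  have hc : Continuous fun q : Matrix (Fin n) (Fin n) F => reTr (B * q) :=
    (reTr ∘ₗ LinearMap.mulLeft ℝ B).continuous_of_finiteDimensional
  obtain ⟨C, hC⟩ := hM.isCompact.exists_bound_of_continuousOn hc.continuousOn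
  exact Integrable.of_bound hc.aestronglyMeasurable C (hM.ae_mem.mono hC)

/-- The linear functional `B ↦ ∫ Re tr (B q)`. -/
def averageForm [FiniteDimensional ℝ F] (hM : IsFullUnitaryGroup M) :
    Matrix (Fin n) (Fin n) F →ₗ[ℝ] ℝ where
  toFun B := ∫ q, reTr (B * q) ∂volumeMeasure M
  map_add' B C := by
    simp only [Matrix.add_mul, map_add]
    exact integral_add (hM.integrable_reTr_mul B) (hM.integrable_reTr_mul C)
  map_smul' r B := by
    simp only [Matrix.smul_mul, map_smul, RingHom.id_apply]
    exact integral_smul r _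

theorem averageForm_mul [FiniteDimensional ℝ F] (hM : IsFullUnitaryGroup M)
    (B : Matrix (Fin n) (Fin n) F) {X : Matrix (Fin n) (Fin n) F} (hX : X ∈ lieAlg M) :
    hM.averageForm (B * X) = 0 := by
  let _ := frobRing (F := F) (m := Fin n)
  let _ := frobAlgebra (F := F) (m := Fin n)
  refine map_mul_eq_zero_of_map_mul_exp (A := Matrix (Fin n) (Fin n) F) hM.averageForm fun t => ?_
  have h := hM.integral_mul_mul (hX t) hM.one_mem fun q => reTr (B * q)
  simp only [conjTranspose_one, Matrix.mul_one, ← Matrix.mul_assoc] at h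
  exact h

theorem averageForm_mul' [FiniteDimensional ℝ F] (hM : IsFullUnitaryGroup M)
    (B : Matrix (Fin n) (Fin n) F) {X : Matrix (Fin n) (Fin n) F} (hX : X ∈ lieAlg M) :
    hM.averageForm (X * B) = 0 := by
  let _ := frobRing (F := F) (m := Fin n)
  let _ := frobAlgebra (F := F) (m := Fin n)
  refine map_mul_eq_zero_of_map_exp_mul (A := Matrix (Fin n) (Fin n) F) hM.averageForm fun t => ?_
  -- The right factor is taken to be `(exp (t • X))ᴴ`, so that its adjoint is `exp (t • X)`;
  -- cyclicity then moves it to the left of `B`.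
  have h := hM.integral_mul_mul hM.one_mem (hM.conjTranspose_mem (hX t)) fun q => reTr (B * q)
  simp only [conjTranspose_conjTranspose, Matrix.one_mul, ← Matrix.mul_assoc] at h
  simp only [reTr_mul_comm _ (exp (t • X)), ← Matrix.mul_assoc] at h
  exact h

theorem conjTranspose_eq_neg {F : Type*} [NormedRing F] [NormedAlgebra ℝ F] [StarRing F]
    [FiniteDimensional ℝ F] [StarModule ℝ F] [ContinuousStar F]
    {M : Set (Matrix (Fin n) (Fin n) F)} (hM : IsFullUnitaryGroup M)
    {X : Matrix (Fin n) (Fin n) F} (hX : X ∈ lieAlg M) : Xᴴ = -X :=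
  have _ : CompleteSpace F := FiniteDimensional.complete ℝ F
  conjTranspose_eq_neg_of_exp fun t => hM.conjTranspose_mul (hX t)

/-- The commutator with `Z = diag(X, Y)`, `X = 0` or `Y = 0`, is orthogonal to `Z` for the kinetic
energy metric at the identity. -/
theorem integral_commutator [FiniteDimensional ℝ F] [StarModule ℝ F] [ContinuousStar F]
    (hM : IsFullUnitaryGroup M) {X Y : Matrix (Fin n) (Fin n) F} (hX : X ∈ lieAlg M)
    (hY : Y ∈ lieAlg M) (hXY : X = 0 ∨ Y = 0) (U : BMat n F) :
    ∫ q, frobInner (mobiusField (fromBlocks X 0 0 Y * U - U * fromBlocks X 0 0 Y) q)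
        (mobiusField (fromBlocks X 0 0 Y) q) ∂volumeMeasure M = 0 := by
  rcases hXY with rfl | rfl
  · rw [integral_congr_ae (hM.ae_mem.mono fun q hq =>
      frobInner_mobiusField_commutator_right (hM.conjTranspose_eq_neg hY) U
        (hM.conjTranspose_mul hq))]
    simp only [← Matrix.mul_assoc _ _ Y, reTr_mul_comm _ Y]
    simp only [← Matrix.mul_assoc Y]
    exact hM.averageForm_mul' _ hY
  · rw [integral_congr_ae (hM.ae_mem.mono fun q hq =>
      frobInner_mobiusField_commutator_left (hM.conjTranspose_eq_neg hX) U
        (hM.mul_conjTranspose hq))]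
    simp only [← Matrix.mul_assoc _ X]
    exact hM.averageForm_mul _ hX

theorem kineticMetric_mul [FiniteDimensional ℝ F] (hM : IsFullUnitaryGroup M) {h : BMat n F}
    (hh : h ∈ splitU n F) (V W : BMat n F) :
    kineticMetric M h (V * h) (W * h)
      = ∫ q, frobInner (mobiusField V (mobius h q)) (mobiusField W (mobius h q))
          ∂volumeMeasure M := by
  refine integral_congr_ae (hM.ae_mem.mono fun q hq => ?_)
  have hu := isUnit_mobiusDen hh (hM.conjTranspose_mul hq)
  simp only [velocity_mul _ _ hu]

theorem kineticMetric_fromBlocks [FiniteDimensional ℝ F] (hM : IsFullUnitaryGroup M)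
    {a d : Matrix (Fin n) (Fin n) F} (ha : a ∈ M) (hd : d ∈ M) (V W : BMat n F) :
    kineticMetric M (fromBlocks a 0 0 d) (V * fromBlocks a 0 0 d) (W * fromBlocks a 0 0 d)
      = ∫ q, frobInner (mobiusField V q) (mobiusField W q) ∂volumeMeasure M := by
  rw [hM.kineticMetric_mul
    (fromBlocks_mem_splitU (hM.conjTranspose_mul ha) (hM.conjTranspose_mul hd))]
  simp only [mobius_fromBlocks a (hM.conjTranspose_mul hd)]
  exact hM.integral_mul_mul ha hd fun q => frobInner (mobiusField V q) (mobiusField W q)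

theorem koszul_eq_zero [FiniteDimensional ℝ F] [StarModule ℝ F] [ContinuousStar F]
    (hM : IsFullUnitaryGroup M) {X Y : Matrix (Fin n) (Fin n) F} (hX : X ∈ lieAlg M)
    (hY : Y ∈ lieAlg M) (hXY : X = 0 ∨ Y = 0) {U : BMat n F} (hU : U ∈ lieAlg (splitU n F))
    (t : ℝ) :
    koszul (kineticMetric M) (exp (t • (fromBlocks X 0 0 Y : BMat n F))) (fromBlocks X 0 0 Y)
      (fromBlocks X 0 0 Y) U = 0 := by
  have _ : CompleteSpace F := FiniteDimensional.complete ℝ F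
  have hmet : ∀ (s : ℝ) (V W : BMat n F),
      kineticMetric M (exp (s • (fromBlocks X 0 0 Y : BMat n F)))
        (V * exp (s • fromBlocks X 0 0 Y)) (W * exp (s • fromBlocks X 0 0 Y))
      = ∫ q, frobInner (mobiusField V q) (mobiusField W q) ∂volumeMeasure M := fun s V W => by
    rw [exp_smul_fromBlocks]
    exact hM.kineticMetric_fromBlocks (hX s) (hY s) V W
  have hmem : exp (t • (fromBlocks X 0 0 Y : BMat n F)) ∈ splitU n F := by
    rw [exp_smul_fromBlocks]
    exact fromBlocks_mem_splitU (hM.conjTranspose_mul (hX t)) (hM.conjTranspose_mul (hY t))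
  have hderivZ : ∀ V W : BMat n F, dirDeriv (fromBlocks X 0 0 Y)
      (fun h => kineticMetric M h (V * h) (W * h)) (exp (t • fromBlocks X 0 0 Y)) = 0 := by
    intro V W
    simp only [dirDeriv, ← matrix_exp_add_smul, hmet, deriv_const]
  have hderivU : dirDeriv U (fun h => kineticMetric M h (fromBlocks X 0 0 Y * h)
      (fromBlocks X 0 0 Y * h)) (exp (t • fromBlocks X 0 0 Y)) = 0 := by
    -- The point `exp (s • U) * exp (t • Z)` lies in `splitU` and need not be block diagonal, but it
    -- still sends unitary matrices to unitary ones, where the length is constant.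
    have hconst : ∀ s : ℝ, kineticMetric M (exp (s • U) * exp (t • fromBlocks X 0 0 Y))
        (fromBlocks X 0 0 Y * (exp (s • U) * exp (t • fromBlocks X 0 0 Y)))
        (fromBlocks X 0 0 Y * (exp (s • U) * exp (t • fromBlocks X 0 0 Y)))
        = ∫ _, (reTr (Xᴴ * X) + reTr (Yᴴ * Y)) ∂volumeMeasure M := fun s => by
      have hs := mul_mem_splitU (hU s) hmem
      rw [hM.kineticMetric_mul hs]
      exact integral_congr_ae (hM.ae_mem.mono fun q hq => frobInner_mobiusField_self hXY
        (conjTranspose_mobius_mul_self hs (hM.conjTranspose_mul hq)))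
    simp only [dirDeriv, hconst, deriv_const]
  have hZU := hM.integral_commutator hX hY hXY U
  -- Replacing `U` by `-U` gives the commutator in the opposite order.
  have hUZ := hM.integral_commutator hX hY hXY (-U)
  rw [koszul, hderivZ, hderivZ, hderivU, hmet, hmet, hmet]
  rw [Matrix.mul_neg, Matrix.neg_mul, sub_neg_eq_add, neg_add_eq_sub] at hUZ
  have hzero : ∀ V W : BMat n F,
      ∫ q, frobInner (mobiusField (rbr V V) q) (mobiusField W q) ∂volumeMeasure M = 0 := by
    intro V W
    have h0 : ∀ q, mobiusField (rbr V V) q = 0 := fun q => by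
      rw [rbr, sub_self, ← fromBlocks_zero, mobiusField_fromBlocks]
      simp
    simp [h0, frobInner_eq_reTr]
  rw [hzero]
  simp only [rbr, hZU, hUZ]
  simp

end IsFullUnitaryGroup

end Volume

/-! ### The geodesic equation and the three families of groups. -/

theorem kineticMetric_zero_left (M : Set (Matrix (Fin n) (Fin n) F)) (g W : BMat n F) :
    kineticMetric M g 0 W = 0 := by
  simp [kineticMetric, velocity, frobInner_eq_reTr]

theorem isGeodesic_exp [FiniteDimensional ℝ F] [StarModule ℝ F] [ContinuousStar F]
    {M : Set (Matrix (Fin n) (Fin n) F)} (hM : IsFullUnitaryGroup M) {G : Set (BMat n F)}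
    (hG : lieAlg G ⊆ lieAlg (splitU n F)) {X Y : Matrix (Fin n) (Fin n) F} (hX : X ∈ lieAlg M)
    (hY : Y ∈ lieAlg M) (hXY : X = 0 ∨ Y = 0) (hZ : fromBlocks X 0 0 Y ∈ lieAlg G) :
    IsGeodesic G (kineticMetric M) fun t : ℝ => exp (t • (fromBlocks X 0 0 Y : BMat n F)) := by
  have _ : CompleteSpace F := FiniteDimensional.complete ℝ F
  refine ⟨matrix_contDiff_exp_smul _, hZ, fun _ => fromBlocks X 0 0 Y, contDiff_const,
    fun t => ⟨hZ, matrix_hasDerivAt_exp_smul _ t⟩, fun t => ⟨0, ⟨fun s => ?_, fun U hU => ?_⟩, ?_⟩⟩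
  -- `0` lies in `lieAlg G` because `1 = exp (0 • Z)` lies in `G`.
  · simpa using hZ 0
  · rw [hM.koszul_eq_zero hX hY hXY (hG hU) t, Matrix.zero_mul, kineticMetric_zero_left,
      mul_zero]
  · rw [add_zero]
    exact deriv_const t _

theorem lieAlg_mono {A : Type*} [Ring A] [TopologicalSpace A] [IsTopologicalRing A] [Module ℝ A]
    {G H : Set A} (h : G ⊆ H) : lieAlg G ⊆ lieAlg H :=
  fun _ hX t => h (hX t)

theorem blockProd_subset_splitU {F : Type*} [NormedRing F] [NormedAlgebra ℝ F] [StarRing F]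
    {M : Set (Matrix (Fin n) (Fin n) F)}
    (hM : IsFullUnitaryGroup M) : blockProd M ⊆ splitU n F := by
  rintro _ ⟨a, ha, d, hd, rfl⟩
  exact fromBlocks_mem_splitU (hM.conjTranspose_mul ha) (hM.conjTranspose_mul hd)

theorem zero_mem_lieAlg {F : Type*} [NormedRing F] [NormedAlgebra ℝ F] [StarRing F]
    {M : Set (Matrix (Fin n) (Fin n) F)} (hM : IsFullUnitaryGroup M) :
    (0 : Matrix (Fin n) (Fin n) F) ∈ lieAlg M := fun t => by
  simpa using hM.one_mem

/-- One-parameter groups generated by `diag(X, 0)` or `diag(0, X)` are geodesics of every group of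
isometries of the split form which contains them. -/
theorem isGeodesic_exp_of_eq [FiniteDimensional ℝ F] [StarModule ℝ F] [ContinuousStar F]
    {M : Set (Matrix (Fin n) (Fin n) F)} (hM : IsFullUnitaryGroup M) {G : Set (BMat n F)}
    (hG : lieAlg G ⊆ lieAlg (splitU n F)) {X : Matrix (Fin n) (Fin n) F} (hX : X ∈ lieAlg M)
    {Z : BMat n F} (hZ : Z ∈ lieAlg G)
    (hZX : Z = fromBlocks X 0 0 0 ∨ Z = fromBlocks 0 0 0 X) :
    IsGeodesic G (kineticMetric M) fun t : ℝ => exp (t • Z) := by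
  rcases hZX with rfl | rfl
  · exact isGeodesic_exp hM hG hX (zero_mem_lieAlg hM) (Or.inr rfl) hZ
  · exact isGeodesic_exp hM hG (zero_mem_lieAlg hM) hX (Or.inl rfl) hZ

theorem isClosed_unitary_matrix {F : Type*} [NormedRing F] [StarRing F] [ContinuousStar F] :
    IsClosed (unitary (Matrix (Fin n) (Fin n) F) : Set (Matrix (Fin n) (Fin n) F)) := by
  have h1 : Continuous fun p : Matrix (Fin n) (Fin n) F => star p * p :=
    continuous_star.mul continuous_id
  have h2 : Continuous fun p : Matrix (Fin n) (Fin n) F => p * star p :=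
    continuous_id.mul continuous_star
  exact (isClosed_eq h1 continuous_const).inter (isClosed_eq h2 continuous_const)

theorem isFullUnitaryGroup_unitary {F : Type*} [NormedRing F] [NormedAlgebra ℝ F] [StarRing F]
    [FiniteDimensional ℝ F] [StarModule ℝ F] [ContinuousStar F] :
    IsFullUnitaryGroup
      (unitary (Matrix (Fin n) (Fin n) F) : Set (Matrix (Fin n) (Fin n) F)) where
  one_mem := one_mem (unitary _)
  mul_mem hp hq := (unitary _).mul_mem hp hq
  conjTranspose_mem hp := Unitary.star_mem hp
  conjTranspose_mul hp := Unitary.star_mul_self_of_mem hp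
  isClosed := isClosed_unitary_matrix
  skew_mem hS t := by
    have _ : CompleteSpace F := FiniteDimensional.complete ℝ F
    have h := exp_conjTranspose_mul_exp_of_skew hS t
    exact Unitary.mem_iff.2 ⟨h, mul_conjTranspose_self h⟩

theorem isFullUnitaryGroup_SOn (n : ℕ) : IsFullUnitaryGroup (SOn n) where
  one_mem := one_mem (specialOrthogonalGroup (Fin n) ℝ)
  mul_mem hp hq := (specialOrthogonalGroup (Fin n) ℝ).mul_mem hp hq
  conjTranspose_mem {p} hp := by
    obtain ⟨h1, h2⟩ := mem_specialOrthogonalGroup_iff.1 hp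
    refine mem_specialOrthogonalGroup_iff.2 ⟨Unitary.star_mem h1, ?_⟩
    rw [det_conjTranspose, h2, star_one]
  conjTranspose_mul hp := Unitary.star_mul_self_of_mem (mem_specialOrthogonalGroup_iff.1 hp).1
  isClosed := by
    have h : SOn n = (unitary (Matrix (Fin n) (Fin n) ℝ) : Set _) ∩ {p | p.det = 1} :=
      Set.ext fun p => mem_specialOrthogonalGroup_iff
    rw [h]
    exact isClosed_unitary_matrix.inter (isClosed_eq continuous_id.matrix_det continuous_const)
  skew_mem {S} hS t := by
    have hu : ∀ s : ℝ, exp (s • S) ∈ unitary (Matrix (Fin n) (Fin n) ℝ) :=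
      isFullUnitaryGroup_unitary.skew_mem hS
    refine mem_specialOrthogonalGroup_iff.2 ⟨hu t, ?_⟩
    -- Over the reals `det (exp (t • S))` is the square of `det (exp ((t / 2) • S))`, which is `1`
    -- by orthogonality.
    have h := congrArg det (Unitary.star_mul_self_of_mem (hu (t / 2)))
    rw [star_eq_conjTranspose, det_mul, det_conjTranspose, star_trivial, det_one] at h
    rw [← add_halves t, matrix_exp_add_smul, det_mul, h]

theorem KReal_subset_splitU (n : ℕ) : KReal n ⊆ splitU n ℝ :=
  blockProd_subset_splitU (isFullUnitaryGroup_SOn n)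

/-- A one-parameter group is connected and contains `1`, so it cannot leave the identity component.
-/
theorem lieAlg_OoSplit (n : ℕ) : lieAlg (OoSplit n) = lieAlg (splitU n ℝ) := by
  refine (lieAlg_mono (connectedComponentIn_subset _ _)).antisymm fun Z hZ t => ?_
  have hc : Continuous fun s : ℝ => exp (s • Z) := (matrix_contDiff_exp_smul Z).continuous
  refine (isPreconnected_range hc).subset_connectedComponentIn ⟨0, by simp⟩ ?_ ⟨t, rfl⟩
  rintro _ ⟨s, rfl⟩
  exact hZ s

theorem KComplex_subset_SUSplit (n : ℕ) : KComplex n ⊆ SUSplit n := fun _ hg =>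
  ⟨blockProd_subset_splitU (M := Un n) isFullUnitaryGroup_unitary hg.1, hg.2⟩

instance : StarModule ℝ ℍ[ℝ] where
  star_smul r x := by ext <;> simp

theorem KQuat_subset_SpSplit (n : ℕ) : KQuat n ⊆ SpSplit n :=
  blockProd_subset_splitU (M := Spn n) isFullUnitaryGroup_unitary

end Mobius

end

/-- One-parameter groups of rigid motions generated by `diag(X, 0)` or `diag(0, X)` are geodesics
of `K` and of `G`, for the kinetic energy metric of the Möbius action of `G` on `M`. -/
theorem theorem1p5 :
    (∀ n : ℕ, 2 < n →
      ∀ X ∈ lieAlg (SOn n), ∀ Z ∈ lieAlg (KReal n),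
        (Z = fromBlocks X 0 0 0 ∨ Z = fromBlocks 0 0 0 X) →
          IsGeodesic (KReal n) (kineticMetric (SOn n)) (fun t : ℝ => exp (t • Z)) ∧
          IsGeodesic (OoSplit n) (kineticMetric (SOn n)) (fun t : ℝ => exp (t • Z))) ∧
    (∀ n : ℕ, 1 ≤ n →
      ∀ X ∈ lieAlg (Un n), ∀ Z ∈ lieAlg (KComplex n),
        (Z = fromBlocks X 0 0 0 ∨ Z = fromBlocks 0 0 0 X) →
          IsGeodesic (KComplex n) (kineticMetric (Un n)) (fun t : ℝ => exp (t • Z)) ∧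
          IsGeodesic (SUSplit n) (kineticMetric (Un n)) (fun t : ℝ => exp (t • Z))) ∧
    (∀ n : ℕ, 1 ≤ n →
      ∀ X ∈ lieAlg (Spn n), ∀ Z ∈ lieAlg (KQuat n),
        (Z = fromBlocks X 0 0 0 ∨ Z = fromBlocks 0 0 0 X) →
          IsGeodesic (KQuat n) (kineticMetric (Spn n)) (fun t : ℝ => exp (t • Z)) ∧
          IsGeodesic (SpSplit n) (kineticMetric (Spn n)) (fun t : ℝ => exp (t • Z))) := by
  refine ⟨fun n _ X hX Z hZ hZX => ?_, fun n _ X hX Z hZ hZX => ?_, fun n _ X hX Z hZ hZX => ?_⟩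
  · have hM := isFullUnitaryGroup_SOn n
    have hK := lieAlg_mono (KReal_subset_splitU n)
    have hG := lieAlg_OoSplit n
    exact ⟨isGeodesic_exp_of_eq hM hK hX hZ hZX,
      isGeodesic_exp_of_eq hM hG.subset hX (hG ▸ hK hZ) hZX⟩
  · have hM : IsFullUnitaryGroup (Un n) := isFullUnitaryGroup_unitary
    have hG : lieAlg (SUSplit n) ⊆ lieAlg (splitU n ℂ) := lieAlg_mono fun _ hg => hg.1
    have hK := lieAlg_mono (KComplex_subset_SUSplit n)
    exact ⟨isGeodesic_exp_of_eq hM (hK.trans hG) hX hZ hZX,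
      isGeodesic_exp_of_eq hM hG hX (hK hZ) hZX⟩
  · have hM : IsFullUnitaryGroup (Spn n) := isFullUnitaryGroup_unitary
    have hK := lieAlg_mono (KQuat_subset_SpSplit n)
    exact ⟨isGeodesic_exp_of_eq hM hK hX hZ hZX,
      isGeodesic_exp_of_eq hM subset_rfl hX (hK hZ) hZX⟩
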